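/- Let $G$ be a finite simple graph with vertex set $V(G)$ and weight function $w:V(G)\to\mathbb{Z}_{>0}$, and fix a total order on $V(G)$. Let $$X_G=\sum_{\kappa}\prod_{v\in V(G)}x_{\kappa(v)}^{w(v)}$$ be its chromatic symmetric function, a power series in $x_1,x_2,\dots$ over a commutative ring, where $\kappa$ ranges over all proper colorings $\kappa:V(G)\to\mathbb{Z}_{>0}$ of $G$. For a partition $\lambda$ with parts $\lambda_1,\dots,\lambda_\ell$, write $\ell(\lambda)=\ell$ and $p_\lambda=\prod_{i=1}^{\ell}\bigl(x_1^{\lambda_i}+x_2^{\lambda_i}+\cdots\bigr)$. Let $\mathcal{AO}(G)$ be the set of acyclic orientations of $G$, i.e. of choices of a direction for every edge such that there is no directed cycle. For $\gamma\in\mathcal{AO}(G)$, the source components of $\gamma$ are constructed as follows, starting with all vertices unused: take the first unused vertex $s$ in the fixed order; the next source component consists of $s$ and all unused vertices reachable from $s$ by directed paths in $\gamma$; mark its vertices as used; repeat until no unused vertex is left. Let $\lambda(\gamma)$ be the partition whose parts are the weights of the source components of $\gamma$, where the weight of a set of vertices is the sum of the weights of its elements. Then $$X_G=(-1)^{|V(G)|}\sum_{\gamma\in\mathcal{AO}(G)}(-1)^{\ell(\lambda(\gamma))}\,p_{\lambda(\gamma)}.$$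 -/

import Mathlib

open scoped BigOperators

noncomputable section

/-! ### Formal infinite sums of power series, in the variables `x_i`, `i` a positive integer -/

/-- The coefficientwise sum of a family of power series in `x_1, x_2, …`. It is the usual formal
sum as soon as every monomial occurs in only finitely many members of the family
(`finite_coeff_pow_ne_zero` and `finite_coeff_colouring_ne_zero` check this below for the families
that it is applied to). -/
def formalSum {R : Type*} [CommRing R] {ι : Type*} (f : ι → MvPowerSeries ℕ+ R) :
    MvPowerSeries ℕ+ R :=
  fun d => ∑ᶠ i, MvPowerSeries.coeff d (f i)

/-- The power sum `p_n = x_1 ^ n + x_2 ^ n + ⋯` (meaningful for `n ≥ 1`). -/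
def powerSum (R : Type*) [CommRing R] (n : ℕ) : MvPowerSeries ℕ+ R :=
  formalSum fun i : ℕ+ => (MvPowerSeries.X i : MvPowerSeries ℕ+ R) ^ n

/-- The power sum symmetric function `p_μ`, the product of the `p_n` over the parts `n` of `μ`,
taken with multiplicity. -/
def powerSumPartition (R : Type*) [CommRing R] {N : ℕ} (μ : Nat.Partition N) :
    MvPowerSeries ℕ+ R :=
  (μ.parts.map (powerSum R)).prod

/-- The chromatic symmetric function of the weighted graph `(G, w)`: the sum over all proper
colourings `κ` of `G` by positive integers of the monomials `∏ v, x_{κ v} ^ (w v)`. -/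
def chromaticSymmetricFunction (R : Type*) [CommRing R] {V : Type*} [Fintype V]
    (G : SimpleGraph V) (w : V → ℕ+) : MvPowerSeries ℕ+ R :=
  formalSum fun κ : G.Coloring ℕ+ =>
    ∏ v : V, (MvPowerSeries.X (κ v) : MvPowerSeries ℕ+ R) ^ (w v : ℕ)

theorem finite_coeff_pow_ne_zero (R : Type*) [CommRing R] {n : ℕ} (hn : 0 < n) (d : ℕ+ →₀ ℕ) :
    {i : ℕ+ | MvPowerSeries.coeff d ((MvPowerSeries.X i : MvPowerSeries ℕ+ R) ^ n) ≠ 0}.Finite := by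
  classical
  refine d.support.finite_toSet.subset fun i hi => ?_
  simp only [Set.mem_ofPred_eq, MvPowerSeries.coeff_X_pow, ne_eq, ite_eq_right_iff,
    Classical.not_imp] at hi
  simp [hi.1, hn.ne']

theorem finite_coeff_colouring_ne_zero (R : Type*) [CommRing R] {V : Type*} [Fintype V]
    (G : SimpleGraph V) (w : V → ℕ+) (d : ℕ+ →₀ ℕ) :
    {κ : G.Coloring ℕ+ | MvPowerSeries.coeff d
      (∏ v : V, (MvPowerSeries.X (κ v) : MvPowerSeries ℕ+ R) ^ (w v : ℕ)) ≠ 0}.Finite := by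
  classical
  have key : ∀ κ : G.Coloring ℕ+,
      (∏ v : V, (MvPowerSeries.X (κ v) : MvPowerSeries ℕ+ R) ^ (w v : ℕ)) =
        MvPowerSeries.monomial (∑ v : V, Finsupp.single (κ v) (w v : ℕ)) 1 := by
    intro κ
    simp only [MvPowerSeries.X_pow_eq]
    induction (Finset.univ : Finset V) using Finset.induction_on with
    | empty => simp
    | insert a s ha ih =>
      rw [Finset.prod_insert ha, Finset.sum_insert ha, ih, MvPowerSeries.monomial_mul_monomial,
        one_mul]
  have hfin : (Set.pi Set.univ fun _ : V => (d.support : Set ℕ+)).Finite :=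
    Set.Finite.pi fun _ => d.support.finite_toSet
  refine (hfin.preimage (f := fun κ : G.Coloring ℕ+ => (κ : V → ℕ+))
    (DFunLike.coe_injective.injOn)).subset fun κ hκ => ?_
  simp only [Set.mem_ofPred_eq, key, MvPowerSeries.coeff_monomial, ne_eq, ite_eq_right_iff,
    Classical.not_imp] at hκ
  intro v _
  have h1 : (w v : ℕ) ≤ d (κ v) := by
    rw [hκ.1, Finsupp.finsetSum_apply]
    refine le_trans ?_ (Finset.single_le_sum
      (f := fun u => (Finsupp.single (κ u) (w u : ℕ)) (κ v))
      (fun _ _ => Nat.zero_le _) (Finset.mem_univ v))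
    simp
  have h2 := (w v).pos
  simp only [Finset.mem_coe, Finsupp.mem_support_iff]
  omega

/-! ### Acyclic orientations and source components -/

/-- An acyclic orientation of `G`. `dir u v` says that the edge `uv` is directed from `u` to `v`.
Every edge gets at least one direction, and not both, since `u → v → u` would be a cycle. -/
@[ext]
structure AcyclicOrientation {V : Type*} (G : SimpleGraph V) where
  dir : V → V → Prop
  adj_iff : ∀ u v, G.Adj u v ↔ dir u v ∨ dir v u
  acyclic : ∀ v, ¬ Relation.TransGen dir v v

instance AcyclicOrientation.instFinite {V : Type*} [Finite V] (G : SimpleGraph V) :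
    Finite (AcyclicOrientation G) :=
  Finite.of_injective (fun γ : AcyclicOrientation G => γ.dir) fun _ _ h =>
    AcyclicOrientation.ext h

instance AcyclicOrientation.instFintype {V : Type*} [Finite V] (G : SimpleGraph V) :
    Fintype (AcyclicOrientation G) :=
  Fintype.ofFinite _

namespace AcyclicOrientation

variable {V : Type*} {G : SimpleGraph V}

open scoped Classical in
/-- The vertices of `U` reachable from `s` by a directed path (possibly of length zero). -/
def reachableIn (γ : AcyclicOrientation G) (U : Finset V) (s : V) : Finset V :=
  U.filter fun v => Relation.ReflTransGen γ.dir s v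

theorem min'_mem_reachableIn [LinearOrder V] (γ : AcyclicOrientation G) (U : Finset V) (h : U.Nonempty) :
    U.min' h ∈ γ.reachableIn U (U.min' h) := by
  simp [reachableIn, Finset.min'_mem, Relation.ReflTransGen.refl]

theorem reachableIn_subset (γ : AcyclicOrientation G) (U : Finset V) (s : V) :
    γ.reachableIn U s ⊆ U :=
  fun v hv => by
    classical
    simp only [reachableIn, Finset.mem_filter] at hv
    exact hv.1

variable [LinearOrder V]

/-- The source components built from the set `U` of unused vertices: the first one consists of the
first unused vertex and all unused vertices reachable from it; then these vertices become used,
and the construction is repeated until no unused vertex is left. -/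
def sourceComponentsFrom (γ : AcyclicOrientation G) (U : Finset V) : List (Finset V) :=
  if h : U.Nonempty then
    γ.reachableIn U (U.min' h) ::
      γ.sourceComponentsFrom (U \ γ.reachableIn U (U.min' h))
  else []
termination_by U.card
decreasing_by
  exact Finset.card_lt_card (Finset.sdiff_ssubset (γ.reachableIn_subset U _)
    ⟨_, γ.min'_mem_reachableIn U h⟩)

/-- The source components of an acyclic orientation, for the given order of the vertices. -/
def sourceComponents [Fintype V] (γ : AcyclicOrientation G) : List (Finset V) :=
  γ.sourceComponentsFrom Finset.univ

theorem nonempty_of_mem_sourceComponentsFrom (γ : AcyclicOrientation G) (U : Finset V) :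
    ∀ C ∈ γ.sourceComponentsFrom U, C.Nonempty := by
  induction U using Finset.strongInduction with
  | H U ih =>
    intro C hC
    rw [sourceComponentsFrom] at hC
    split_ifs at hC with h
    · rcases List.mem_cons.1 hC with rfl | hC
      · exact ⟨_, γ.min'_mem_reachableIn U h⟩
      · exact ih _ (Finset.sdiff_ssubset (γ.reachableIn_subset U _)
          ⟨_, γ.min'_mem_reachableIn U h⟩) C hC
    · simp at hC

theorem sum_sourceComponentsFrom (γ : AcyclicOrientation G) (w : V → ℕ+) (U : Finset V) :
    ((γ.sourceComponentsFrom U).map fun C => ∑ v ∈ C, (w v : ℕ)).sum = ∑ v ∈ U, (w v : ℕ) := by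
  induction U using Finset.strongInduction with
  | H U ih =>
    rw [sourceComponentsFrom]
    split_ifs with h
    · rw [List.map_cons, List.sum_cons, ih _ (Finset.sdiff_ssubset (γ.reachableIn_subset U _)
          ⟨_, γ.min'_mem_reachableIn U h⟩), add_comm]
      exact Finset.sum_sdiff (γ.reachableIn_subset U _)
    · simp [Finset.not_nonempty_iff_eq_empty.1 h]

/-- The partition of the total weight of the graph whose parts are the weights of the source
components of `γ`, the weight of a set of vertices being the sum of the weights of its members. -/
def sourcePartition [Fintype V] (γ : AcyclicOrientation G) (w : V → ℕ+) :
    Nat.Partition (∑ v : V, (w v : ℕ)) where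
  parts := ((γ.sourceComponents.map fun C => ∑ v ∈ C, (w v : ℕ) : List ℕ) : Multiset ℕ)
  parts_pos := by
    intro i hi
    rw [Multiset.mem_coe, List.mem_map] at hi
    obtain ⟨C, hC, rfl⟩ := hi
    exact Finset.sum_pos (fun v _ => (w v).pos) (γ.nonempty_of_mem_sourceComponentsFrom _ C hC)
  parts_sum := by
    rw [Multiset.sum_coe]
    exact γ.sum_sourceComponentsFrom w Finset.univ

end AcyclicOrientation

end

/-! ### Restricted graphs, and cutting an orientation along a closed set. -/

section

/-! Expanding the power sums, (-1)^ℓ p_λ(γ) becomes a signed sum of monomials over the colourings κ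
that are constant on every source component of γ. So it suffices that, for each fixed κ, the γ whose
source components are all κ-constant, counted with sign (-1)^ℓ, total (-1)^|V| if κ is proper and 0
otherwise (`sum_componentSign`).

This is shown on every vertex set U by induction. Let m be the first vertex of U. Choosing γ means
choosing the first source component B ∋ m, an acyclic orientation of B in which m reaches
everything, and any acyclic orientation of U \ B; the edges in between must point into B
(`splitEquiv`, `sum_componentSign_of_nonempty`). In the graph H of monochromatic edges, a set
reachable from m is automatically κ-constant, so the induction step is an identity about H alone:
Σ_B r(B) s(U \ B) = -s(U), with r = `rootedCount` and s = `stableSign`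
(`sum_rootedCount_mul_stableSign`).

For that identity, point all edges between B and the stable set S = U \ B into S. The terms become
pairs (γ, S), where S is a set of sinks of γ avoiding m whose complement is reachable from m.
Toggling in S a sink that has an incoming edge cancels everything, unless H has no edge inside U. -/

/-- The graph on all of `V` whose edges are the edges of `G` inside `U`. -/
def SimpleGraph.restrictTo {V : Type*} (G : SimpleGraph V) (U : Finset V) : SimpleGraph V where
  Adj u v := G.Adj u v ∧ u ∈ U ∧ v ∈ U
  symm := ⟨fun _ _ h => ⟨h.1.symm, h.2.2, h.2.1⟩⟩
  loopless := ⟨fun _ h => G.loopless.irrefl _ h.1⟩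

/-- The edges of `G` that are monochromatic under `κ`. -/
def SimpleGraph.monochromatic {V α : Type*} (G : SimpleGraph V) (κ : V → α) : SimpleGraph V where
  Adj u v := G.Adj u v ∧ κ u = κ v
  symm := ⟨fun _ _ h => ⟨h.1.symm, h.2.symm⟩⟩
  loopless := ⟨fun _ h => G.loopless.irrefl _ h.1⟩

theorem SimpleGraph.restrictTo_univ {V : Type*} [Fintype V] (G : SimpleGraph V) :
    G.restrictTo Finset.univ = G := by
  ext u v
  simp [SimpleGraph.restrictTo]

/-- The function `κ` is constant on `C`. -/
def ConstantOn {V α : Type*} (κ : V → α) (C : Finset V) : Prop :=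
  ∀ u ∈ C, ∀ v ∈ C, κ u = κ v

theorem SimpleGraph.restrictTo_monochromatic {V α : Type*} (G : SimpleGraph V) {κ : V → α}
    {B : Finset V} (h : ConstantOn κ B) :
    (G.monochromatic κ).restrictTo B = G.restrictTo B := by
  ext u v
  simp only [SimpleGraph.restrictTo, SimpleGraph.monochromatic]
  exact ⟨fun ⟨⟨a, _⟩, b⟩ => ⟨a, b⟩, fun ⟨a, b⟩ => ⟨⟨a, h u b.1 v b.2⟩, b⟩⟩

namespace AcyclicOrientation

variable {V : Type*} {G : SimpleGraph V}

/-- The set `B` is closed under following edges of `γ`. -/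
def Closed (γ : AcyclicOrientation G) (B : Finset V) : Prop :=
  ∀ u v, γ.dir u v → u ∈ B → v ∈ B

/-- All vertices of `B` are reachable from `m`. -/
def Rooted (γ : AcyclicOrientation G) (m : V) (B : Finset V) : Prop :=
  ∀ v ∈ B, Relation.ReflTransGen γ.dir m v

theorem adj_of_dir (γ : AcyclicOrientation G) {u v : V} (h : γ.dir u v) : G.Adj u v :=
  (γ.adj_iff u v).2 (Or.inl h)

theorem mem_of_dir {U : Finset V} (γ : AcyclicOrientation (G.restrictTo U)) {u v : V}
    (h : γ.dir u v) : u ∈ U ∧ v ∈ U :=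
  (γ.adj_of_dir h).2

theorem Closed.mem_of_reflTransGen {γ : AcyclicOrientation G} {B : Finset V} (hB : γ.Closed B)
    {u v : V} (h : Relation.ReflTransGen γ.dir u v) (hu : u ∈ B) : v ∈ B := by
  induction h with
  | refl => exact hu
  | tail _ h ih => exact hB _ _ h ih

/-- The restriction of an acyclic orientation to a smaller set of vertices. -/
def restrict {U : Finset V} (γ : AcyclicOrientation (G.restrictTo U)) (W : Finset V)
    (hW : W ⊆ U) : AcyclicOrientation (G.restrictTo W) where
  dir u v := γ.dir u v ∧ u ∈ W ∧ v ∈ W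
  adj_iff u v := by
    have h := γ.adj_iff u v
    constructor
    · rintro ⟨h1, h2, h3⟩
      rcases h.1 ⟨h1, hW h2, hW h3⟩ with h | h
      · exact Or.inl ⟨h, h2, h3⟩
      · exact Or.inr ⟨h, h3, h2⟩
    · rintro (⟨h1, h2, h3⟩ | ⟨h1, h3, h2⟩)
      · exact ⟨(h.2 (Or.inl h1)).1, h2, h3⟩
      · exact ⟨(h.2 (Or.inr h1)).1, h2, h3⟩
  acyclic v h := γ.acyclic v (Relation.TransGen.mono (fun _ _ h => h.1) _ _ h)

theorem Closed.restrict_reach_iff {U : Finset V} {γ : AcyclicOrientation (G.restrictTo U)}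
    {B : Finset V} (hB : γ.Closed B) (hBU : B ⊆ U) {u v : V} (hu : u ∈ B) :
    Relation.ReflTransGen (γ.restrict B hBU).dir u v ↔ Relation.ReflTransGen γ.dir u v := by
  refine ⟨fun h => Relation.ReflTransGen.mono (fun _ _ h => h.1) _ _ h, fun h => ?_⟩
  induction h with
  | refl => exact .refl
  | tail h1 h2 ih =>
    have := hB.mem_of_reflTransGen h1 hu
    exact ih.tail ⟨h2, this, hB _ _ h2 this⟩

variable [DecidableEq V]

/-- A path that ends outside a closed set never met it. -/
theorem Closed.restrict_sdiff_reach_iff {U : Finset V}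
    {γ : AcyclicOrientation (G.restrictTo U)} {B : Finset V} (hB : γ.Closed B) {u v : V}
    (hv : v ∈ U \ B) :
    Relation.ReflTransGen (γ.restrict (U \ B) Finset.sdiff_subset).dir u v ↔
      Relation.ReflTransGen γ.dir u v := by
  refine ⟨fun h => Relation.ReflTransGen.mono (fun _ _ h => h.1) _ _ h, fun h => ?_⟩
  induction h using Relation.ReflTransGen.head_induction_on with
  | refl => exact .refl
  | head h1 h2 ih =>
    rw [Finset.mem_sdiff] at hv
    refine ih.head ⟨h1, ?_, ?_⟩
    · exact Finset.mem_sdiff.2 ⟨(γ.mem_of_dir h1).1, fun h =>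
        hv.2 (hB.mem_of_reflTransGen h2 (hB _ _ h1 h))⟩
    · exact Finset.mem_sdiff.2 ⟨(γ.mem_of_dir h1).2, fun h =>
        hv.2 (hB.mem_of_reflTransGen h2 h)⟩

/-- Glue acyclic orientations on `U \ B` and on `B`, directing all edges between the two sets
towards `B`. -/
def glue {U B : Finset V} (hBU : B ⊆ U) (α : AcyclicOrientation (G.restrictTo (U \ B)))
    (β : AcyclicOrientation (G.restrictTo B)) : AcyclicOrientation (G.restrictTo U) where
  dir u v := α.dir u v ∨ β.dir u v ∨ (G.Adj u v ∧ u ∈ U \ B ∧ v ∈ B)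
  adj_iff u v := by
    have hα := α.adj_iff u v
    have hβ := β.adj_iff u v
    simp only [SimpleGraph.restrictTo, Finset.mem_sdiff] at hα hβ ⊢
    have hs := G.adj_comm u v
    have h1 := @hBU u
    have h2 := @hBU v
    tauto
  acyclic v h := by
    -- A path may enter `B` but cannot leave it, so a cycle would lie entirely in `α` or entirely in
    -- `β`.
    have key : ∀ a b, Relation.TransGen (fun u v => α.dir u v ∨ β.dir u v ∨
        (G.Adj u v ∧ u ∈ U \ B ∧ v ∈ B)) a b →
        (a ∈ B → b ∈ B ∧ Relation.TransGen β.dir a b) ∧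
        (b ∉ B → a ∉ B ∧ Relation.TransGen α.dir a b) := by
      have step : ∀ a b, (α.dir a b ∨ β.dir a b ∨ (G.Adj a b ∧ a ∈ U \ B ∧ b ∈ B)) →
          (a ∈ B → b ∈ B ∧ β.dir a b) ∧ (b ∉ B → a ∉ B ∧ α.dir a b) := by
        intro a b h
        have hα := @mem_of_dir V G _ α a b
        have hβ := @mem_of_dir V G _ β a b
        simp only [Finset.mem_sdiff] at hα h
        tauto
      intro a b h
      induction h with
      | single h =>
        obtain ⟨h1, h2⟩ := step _ _ h
        exact ⟨fun h => ⟨(h1 h).1, .single (h1 h).2⟩, fun h => ⟨(h2 h).1, .single (h2 h).2⟩⟩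
      | tail _ h ih =>
        obtain ⟨h1, h2⟩ := step _ _ h
        refine ⟨fun h => ?_, fun h => ?_⟩
        · obtain ⟨h3, h4⟩ := ih.1 h
          exact ⟨(h1 h3).1, h4.tail (h1 h3).2⟩
        · obtain ⟨h3, h4⟩ := ih.2 (h2 h).1
          exact ⟨h3, h4.tail (h2 h).2⟩
    by_cases hv : v ∈ B
    · exact β.acyclic v ((key v v h).1 hv).2
    · exact α.acyclic v ((key v v h).2 hv).2

/-- Acyclic orientations on `U` for which `B` is closed are pairs of acyclic orientations on
`U \ B` and on `B`. -/
def splitEquiv {U B : Finset V} (hBU : B ⊆ U) :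
    {γ : AcyclicOrientation (G.restrictTo U) // γ.Closed B} ≃
      AcyclicOrientation (G.restrictTo (U \ B)) × AcyclicOrientation (G.restrictTo B) where
  toFun γ := (γ.1.restrict _ Finset.sdiff_subset, γ.1.restrict _ hBU)
  invFun p := ⟨glue hBU p.1 p.2, by
    intro u v h hu
    have h1 := @mem_of_dir V G _ p.1 u v
    have h2 := @mem_of_dir V G _ p.2 u v
    simp only [glue, Finset.mem_sdiff] at h h1
    tauto⟩
  left_inv γ := by
    obtain ⟨γ, hγ⟩ := γ
    apply Subtype.ext
    ext u v
    have h1 := @mem_of_dir V G _ γ u v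
    have h2 := hγ u v
    have h3 := hγ v u
    have h4 := γ.adj_iff u v
    have h5 := @hBU v
    simp only [glue, restrict, SimpleGraph.restrictTo, Finset.mem_sdiff] at h4 ⊢
    tauto
  right_inv p := by
    obtain ⟨α, β⟩ := p
    refine Prod.ext ?_ ?_ <;> ext u v
    all_goals
      have h1 := @mem_of_dir V G _ α u v
      have h2 := @mem_of_dir V G _ β u v
      simp only [glue, restrict, Finset.mem_sdiff] at h1 ⊢
      tauto

-- Used with two kinds of closed set: a set of sinks, and the first source component.
open scoped Classical in
theorem sum_closed {R : Type*} [CommRing R] [Finite V] {U B : Finset V} (hBU : B ⊆ U)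
    (F : AcyclicOrientation (G.restrictTo (U \ B)) → AcyclicOrientation (G.restrictTo B) → R) :
    (∑ γ : AcyclicOrientation (G.restrictTo U), if γ.Closed B then
      F (γ.restrict _ Finset.sdiff_subset) (γ.restrict _ hBU) else 0) = ∑ α, ∑ β, F α β := by
  rw [← Fintype.sum_prod_type', ← Finset.sum_filter,
    ← Equiv.sum_comp (splitEquiv hBU) (fun x => F x.1 x.2), ← Finset.sum_subtype_eq_sum_filter]
  refine Finset.sum_congr ?_ fun _ _ => rfl
  ext; simp

end AcyclicOrientation

end

/-! ### Rooted orientations, stable sets and the sink-toggling involution. -/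

section

open scoped Classical in
/-- The number of acyclic orientations on `B` in which all of `B` is reachable from `m`. -/
noncomputable def rootedCount (R : Type*) [CommRing R] {V : Type*} [Finite V] (G : SimpleGraph V)
    (m : V) (B : Finset V) : R :=
  ∑ β : AcyclicOrientation (G.restrictTo B), if β.Rooted m B then 1 else 0

open scoped Classical in
/-- The sign `(-1) ^ |S|` if `S` is a stable set of `G`, and zero otherwise. -/
noncomputable def stableSign (R : Type*) [CommRing R] {V : Type*} (G : SimpleGraph V)
    (S : Finset V) : R :=
  if ∀ u ∈ S, ∀ v ∈ S, ¬ G.Adj u v then (-1) ^ S.card else 0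

open scoped Classical in
/-- The product over the source components in `U` of `-1` for those on which `κ` is constant, and
of `0` for the others. -/
noncomputable def componentSign (R : Type*) [CommRing R] {V α : Type*} [LinearOrder V]
    {G : SimpleGraph V} (κ : V → α) (γ : AcyclicOrientation G) (U : Finset V) : R :=
  ((γ.sourceComponentsFrom U).map fun C => if ConstantOn κ C then (-1 : R) else 0).prod

namespace AcyclicOrientation

variable {V : Type*} {G : SimpleGraph V}

theorem exists_reachable_sink [Finite V] (γ : AcyclicOrientation G) (v : V) :
    ∃ t, Relation.ReflTransGen γ.dir v t ∧ ∀ u, ¬ γ.dir t u := by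
  have hwf : WellFounded (Function.swap (Relation.TransGen γ.dir)) := by
    have : IsTrans V (Function.swap (Relation.TransGen γ.dir)) := ⟨fun _ _ _ h1 h2 => h2.trans h1⟩
    have : Std.Irrefl (Function.swap (Relation.TransGen γ.dir)) := ⟨γ.acyclic⟩
    exact Finite.wellFounded_of_trans_of_irrefl _
  obtain ⟨t, ht, hmin⟩ := hwf.has_min {t | Relation.ReflTransGen γ.dir v t} ⟨v, .refl⟩
  exact ⟨t, ht, fun u hu => hmin u (ht.tail hu) (.single hu)⟩

/-- An acyclic orientation of a graph with an edge has a sink with an incoming edge. -/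
theorem exists_sink_of_adj [Finite V] (γ : AcyclicOrientation G) {u v : V} (h : G.Adj u v) :
    ∃ p t, γ.dir p t ∧ ∀ x, ¬ γ.dir t x := by
  have key : ∀ a b, γ.dir a b → ∃ p t, γ.dir p t ∧ ∀ x, ¬ γ.dir t x := by
    intro a b hab
    obtain ⟨t, ht, hs⟩ := γ.exists_reachable_sink b
    obtain rfl | ⟨p, -, hp⟩ := Relation.ReflTransGen.cases_tail ht
    · exact ⟨a, _, hab, hs⟩
    · exact ⟨p, t, hp, hs⟩
  rcases (γ.adj_iff u v).1 h with h | h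
  exacts [key _ _ h, key _ _ h]

theorem eq_of_reflTransGen_of_sink (γ : AcyclicOrientation G) {t v : V} (ht : ∀ x, ¬ γ.dir t x)
    (h : Relation.ReflTransGen γ.dir t v) : v = t := by
  obtain rfl | ⟨p, hp, -⟩ := Relation.ReflTransGen.cases_head h
  · rfl
  · exact absurd hp (ht _)

/-- A set of sinks of `γ` whose complement in `U` is reachable from `m`, a vertex outside of it. -/
def SinkComplement (γ : AcyclicOrientation G) (U : Finset V) (m : V) (S : Finset V) : Prop :=
  S ⊆ U ∧ m ∉ S ∧ (∀ s ∈ S, ∀ v, ¬ γ.dir s v) ∧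
    ∀ v ∈ U, v ∉ S → Relation.ReflTransGen γ.dir m v

-- The toggled sink `t`, with an incoming edge `p → t`, depends on `γ` only. Being no sink, `p` lies
-- outside `S`, hence is reachable from `m`; so `t` remains reachable when it is taken out of `S`.
open scoped Classical in
theorem sum_sinkComplement_eq_zero (R : Type*) [CommRing R] [Finite V] {U : Finset V} {m : V}
    (hm : m ∈ U) (γ : AcyclicOrientation (G.restrictTo U)) {u v : V}
    (h : (G.restrictTo U).Adj u v) :
    ∑ S ∈ U.powerset with γ.SinkComplement U m S, (-1 : R) ^ S.card = 0 := by
  obtain ⟨p, t, hpt, ht⟩ := γ.exists_sink_of_adj h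
  have htU := (γ.mem_of_dir hpt).2
  have hpU := (γ.mem_of_dir hpt).1
  -- If `m` were the sink `t`, it would reach only itself, yet it reaches `p`.
  have hne : ∀ S, γ.SinkComplement U m S → t ≠ m := by
    rintro S ⟨h1, h2, h3, h4⟩ rfl
    have hp := γ.eq_of_reflTransGen_of_sink ht (h4 p hpU fun hp => h3 p hp _ hpt)
    exact ht _ (hp ▸ hpt)
  have herase : ∀ S, γ.SinkComplement U m S → γ.SinkComplement U m (S.erase t) := by
    rintro S ⟨h1, h2, h3, h4⟩
    refine ⟨(Finset.erase_subset _ _).trans h1, fun h => h2 (Finset.mem_of_mem_erase h),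
      fun s hs => h3 s (Finset.mem_of_mem_erase hs), fun v hv hvS => ?_⟩
    by_cases hvt : v = t
    · subst hvt
      exact (h4 p hpU fun hp => h3 p hp _ hpt).tail hpt
    · exact h4 v hv fun hv' => hvS (Finset.mem_erase.2 ⟨hvt, hv'⟩)
  have hinsert : ∀ S, γ.SinkComplement U m S → γ.SinkComplement U m (insert t S) := by
    intro S hS
    have := hne S hS
    obtain ⟨h1, h2, h3, h4⟩ := hS
    refine ⟨Finset.insert_subset htU h1, ?_, ?_, fun v hv hvS => h4 v hv fun hv' =>
      hvS (Finset.mem_insert_of_mem hv')⟩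
    · simp [h2, this.symm]
    · intro s hs
      rcases Finset.mem_insert.1 hs with rfl | hs
      exacts [ht, h3 s hs]
  refine Finset.sum_involution (fun S _ => if t ∈ S then S.erase t else insert t S) ?_ ?_ ?_ ?_
  · intro S hS
    by_cases htS : t ∈ S
    · have := Finset.card_erase_add_one htS
      simp only [htS, if_true, ← this, pow_succ]
      ring
    · simp only [htS, if_false, Finset.card_insert_of_notMem htS, pow_succ]
      ring
  · intro S hS _
    by_cases htS : t ∈ S
    · simp only [htS, if_true, ne_eq, Finset.erase_eq_self, not_true_eq_false, not_false_eq_true]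
    · simp only [htS, if_false, ne_eq, Finset.insert_eq_self, not_false_eq_true]
  · intro S hS
    rw [Finset.mem_filter] at hS ⊢
    have : γ.SinkComplement U m (if t ∈ S then S.erase t else insert t S) := by
      split_ifs
      exacts [herase S hS.2, hinsert S hS.2]
    exact ⟨Finset.mem_powerset.2 this.1, this⟩
  · intro S hS
    by_cases htS : t ∈ S
    · simp [htS, Finset.insert_erase htS]
    · simp [htS, Finset.erase_insert htS]

variable [DecidableEq V]

/-- A set of sinks is the same as a closed stable set, which is what `sum_closed` can cut along. -/
theorem sinkComplement_iff {U S : Finset V} (hS : S ⊆ U) {m : V}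
    (γ : AcyclicOrientation (G.restrictTo U)) :
    γ.SinkComplement U m S ↔ m ∉ S ∧ (∀ u ∈ S, ∀ v ∈ S, ¬ G.Adj u v) ∧ γ.Closed S ∧
      (γ.restrict (U \ S) Finset.sdiff_subset).Rooted m (U \ S) := by
  constructor
  · rintro ⟨-, h2, h3, h4⟩
    have hcl : γ.Closed S := fun u v h hu => absurd h (h3 u hu v)
    refine ⟨h2, fun u hu v hv h => ?_, hcl, fun v hv => ?_⟩
    · rcases (γ.adj_iff u v).1 ⟨h, hS hu, hS hv⟩ with h | h
      exacts [h3 u hu v h, h3 v hv u h]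
    · rw [hcl.restrict_sdiff_reach_iff hv]
      rw [Finset.mem_sdiff] at hv
      exact h4 v hv.1 hv.2
  · rintro ⟨h2, h3, h4, h5⟩
    refine ⟨hS, h2, fun s hs v h => h3 s hs v (h4 s v h hs) (γ.adj_of_dir h).1,
      fun v hv hvS => ?_⟩
    have hv' := Finset.mem_sdiff.2 ⟨hv, hvS⟩
    exact (h4.restrict_sdiff_reach_iff hv').1 (h5 v hv')

end AcyclicOrientation

open AcyclicOrientation

variable {V : Type*} [DecidableEq V] [Finite V] (R : Type*) [CommRing R]

instance SimpleGraph.uniqueAcyclicOrientation {W : Type*} (G : SimpleGraph W)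
    [h : Fact (∀ u v, ¬ G.Adj u v)] : Unique (AcyclicOrientation G) where
  default := ⟨fun _ _ => False, by simpa using h.out, fun v hv => by
    cases hv <;> assumption⟩
  uniq γ := by
    ext u v
    exact iff_of_false (fun h' => h.out _ _ (γ.adj_of_dir h')) id

/-- A stable `S` carries exactly one orientation, so gluing it to a rooted orientation of `U \ S`
involves no further choice. -/
theorem rootedCount_mul_stableSign (G : SimpleGraph V) {U S : Finset V} (hS : S ⊆ U) {m : V}
    (hmS : m ∉ S) :
    open scoped Classical in
    rootedCount R G m (U \ S) * stableSign R G S =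
      ∑ γ : AcyclicOrientation (G.restrictTo U),
        if γ.SinkComplement U m S then (-1) ^ S.card else 0 := by
  classical
  by_cases hst : ∀ u ∈ S, ∀ v ∈ S, ¬ G.Adj u v
  · have : Fact (∀ u v, ¬ (G.restrictTo S).Adj u v) := ⟨fun u v h => hst u h.2.1 v h.2.2 h.1⟩
    have h := sum_closed (R := R) (G := G) hS
      (fun α _ => if α.Rooted m (U \ S) then (-1) ^ S.card else 0)
    simp only [Finset.sum_const, Finset.card_univ] at h
    rw [Fintype.card_unique] at h
    rw [rootedCount, stableSign, if_pos hst, Finset.sum_mul]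
    simp only [one_smul, ite_mul, one_mul, zero_mul] at h ⊢
    rw [← h]
    refine Finset.sum_congr rfl fun γ _ => ?_
    simp only [sinkComplement_iff hS, hmS, not_false_eq_true, true_and, ite_and]
    split_ifs <;> simp_all
  · rw [stableSign, if_neg hst, mul_zero]
    refine (Finset.sum_eq_zero fun γ _ => if_neg fun h => hst ?_).symm
    exact ((sinkComplement_iff hS γ).1 h).2.1

theorem sum_rootedCount_mul_stableSign (G : SimpleGraph V) {U : Finset V} {m : V} (hm : m ∈ U) :
    ∑ B ∈ U.powerset with m ∈ B, rootedCount R G m B * stableSign R G (U \ B) =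
      -stableSign R G U := by
  classical
  have h1 : ∑ B ∈ U.powerset with m ∈ B, rootedCount R G m B * stableSign R G (U \ B) =
      ∑ S ∈ U.powerset with m ∉ S, rootedCount R G m (U \ S) * stableSign R G S := by
    refine Finset.sum_nbij' (U \ ·) (U \ ·) ?_ ?_ ?_ ?_ ?_
    · intro B hB
      simp_all
    · intro B hB
      simp_all
    · intro B hB
      simp only [Finset.mem_filter, Finset.mem_powerset] at hB
      simp [hB.1]
    · intro B hB
      simp only [Finset.mem_filter, Finset.mem_powerset] at hB
      simp [hB.1]
    · intro B hB
      simp only [Finset.mem_filter, Finset.mem_powerset] at hB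
      simp [Finset.inter_eq_right.2 hB.1]
  have h2 : ∑ S ∈ U.powerset with m ∉ S, rootedCount R G m (U \ S) * stableSign R G S =
      ∑ γ : AcyclicOrientation (G.restrictTo U),
        ∑ S ∈ U.powerset with γ.SinkComplement U m S, (-1 : R) ^ S.card := by
    simp only [Finset.sum_filter]
    rw [Finset.sum_comm]
    refine Finset.sum_congr rfl fun S hS => ?_
    rw [Finset.mem_powerset] at hS
    split_ifs with hmS
    · exact (Finset.sum_eq_zero fun γ _ => if_neg fun h => h.2.1 hmS).symm
    · exact rootedCount_mul_stableSign R G hS hmS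
  rw [h1, h2]
  by_cases hst : ∀ u ∈ U, ∀ v ∈ U, ¬ G.Adj u v
  · have : Fact (∀ u v, ¬ (G.restrictTo U).Adj u v) := ⟨fun u v h => hst u h.2.1 v h.2.2 h.1⟩
    -- Without edges `m` reaches only itself, so `S` must be all of `U` except `m`; the missing
    -- vertex gives the minus sign.
    rw [Fintype.sum_unique, Finset.sum_eq_single (U.erase m), stableSign, if_pos hst,
      ← Finset.card_erase_add_one hm, pow_succ]
    · ring
    · intro S hS hne
      refine absurd ?_ hne
      obtain ⟨-, h1, h2, h3, h4⟩ := Finset.mem_filter.1 hS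
      ext v
      rw [Finset.mem_erase]
      refine ⟨fun hv => ⟨fun h => h2 (h ▸ hv), h1 hv⟩, fun ⟨hv1, hv2⟩ => ?_⟩
      by_contra hv
      exact hv1 (eq_of_reflTransGen_of_sink _ (fun _ h => h) (h4 v hv2 hv))
    · intro h
      refine absurd (Finset.mem_filter.2 ⟨Finset.mem_powerset.2 (Finset.erase_subset _ _),
        Finset.erase_subset _ _, Finset.notMem_erase _ _, fun _ _ _ h => h, fun v hv hv' => ?_⟩) h
      by_cases h : v = m
      · exact h ▸ .refl
      · exact absurd (Finset.mem_erase.2 ⟨h, hv⟩) hv'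
  · rw [stableSign, if_neg hst, neg_zero]
    push Not at hst
    obtain ⟨u, hu, v, hv, h⟩ := hst
    exact Finset.sum_eq_zero fun γ _ => sum_sinkComplement_eq_zero R hm γ ⟨h, hu, hv⟩

end

/-! ### The signed count of orientations for a fixed colouring. -/

section
open AcyclicOrientation

namespace AcyclicOrientation

variable {V : Type*} {G : SimpleGraph V}

/-- The construction sees only reachability between unused vertices. This allows `γ` to be replaced
by its restriction once the first component is removed. -/
theorem sourceComponentsFrom_congr [LinearOrder V] {G' : SimpleGraph V} (γ : AcyclicOrientation G)
    (γ' : AcyclicOrientation G') (U : Finset V)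
    (h : ∀ u ∈ U, ∀ v ∈ U, Relation.ReflTransGen γ.dir u v ↔ Relation.ReflTransGen γ'.dir u v) :
    γ.sourceComponentsFrom U = γ'.sourceComponentsFrom U := by
  classical
  induction U using Finset.strongInduction with
  | H U ih =>
    rw [sourceComponentsFrom, sourceComponentsFrom]
    split_ifs with hU
    · have hr : γ.reachableIn U (U.min' hU) = γ'.reachableIn U (U.min' hU) :=
        Finset.filter_congr fun v hv => h _ (U.min'_mem hU) v hv
      rw [hr, ih _ (Finset.sdiff_ssubset (γ'.reachableIn_subset U _)
          ⟨_, γ'.min'_mem_reachableIn U hU⟩)]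
      exact fun u hu v hv => h u (Finset.mem_sdiff.1 hu).1 v (Finset.mem_sdiff.1 hv).1
    · rfl

theorem reachableIn_eq_iff {U B : Finset V} (γ : AcyclicOrientation (G.restrictTo U))
    (hBU : B ⊆ U) {m : V} (hm : m ∈ B) :
    γ.reachableIn U m = B ↔ γ.Closed B ∧ (γ.restrict B hBU).Rooted m B := by
  classical
  constructor
  · rintro h
    have hmem : ∀ v, v ∈ B ↔ v ∈ U ∧ Relation.ReflTransGen γ.dir m v := by
      intro v
      rw [← h, reachableIn, Finset.mem_filter]
    have hcl : γ.Closed B := fun u v huv hu =>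
      (hmem v).2 ⟨(γ.mem_of_dir huv).2, ((hmem u).1 hu).2.tail huv⟩
    exact ⟨hcl, fun v hv => (hcl.restrict_reach_iff hBU hm).2 ((hmem v).1 hv).2⟩
  · rintro ⟨hcl, hr⟩
    ext v
    rw [reachableIn, Finset.mem_filter]
    exact ⟨fun h => hcl.mem_of_reflTransGen h.2 hm,
      fun h => ⟨hBU h, (hcl.restrict_reach_iff hBU hm).1 (hr v h)⟩⟩

end AcyclicOrientation

/-- Colours do not change along monochromatic edges, so all vertices reachable from `m` have the
colour of `m`. -/
theorem rootedCount_monochromatic_eq_zero (R : Type*) [CommRing R] {V α : Type*} [Finite V]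
    (G : SimpleGraph V) {κ : V → α} {B : Finset V} (h : ¬ ConstantOn κ B) (m : V) :
    rootedCount R (G.monochromatic κ) m B = 0 := by
  classical
  refine Finset.sum_eq_zero fun γ _ => if_neg fun hγ => h ?_
  have key : ∀ v ∈ B, κ v = κ m := by
    intro v hv
    induction hγ v hv with
    | refl => rfl
    | tail h1 h2 ih => exact (γ.adj_of_dir h2).1.2.symm.trans (ih (γ.mem_of_dir h2).1)
  exact fun u hu v hv => (key u hu).trans (key v hv).symm

variable {V α : Type*} [LinearOrder V] (R : Type*) [CommRing R]

open scoped Classical in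
theorem componentSign_of_nonempty {G : SimpleGraph V} (κ : V → α) (γ : AcyclicOrientation G)
    {U : Finset V} (hU : U.Nonempty) :
    componentSign R κ γ U = (if ConstantOn κ (γ.reachableIn U (U.min' hU)) then -1 else 0) *
      componentSign R κ γ (U \ γ.reachableIn U (U.min' hU)) := by
  rw [componentSign, sourceComponentsFrom, dif_pos hU, List.map_cons, List.prod_cons]
  rfl

-- Orientations are sorted by their first source component `B`; the later components are those of
-- the restriction to `U \ B`.
open scoped Classical in
theorem sum_componentSign_of_nonempty [Finite V] (G : SimpleGraph V) (κ : V → α) {U : Finset V}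
    (hU : U.Nonempty) :
    ∑ γ : AcyclicOrientation (G.restrictTo U), componentSign R κ γ U =
      ∑ B ∈ U.powerset with U.min' hU ∈ B, (if ConstantOn κ B then -1 else 0) *
        rootedCount R G (U.min' hU) B *
        ∑ γ : AcyclicOrientation (G.restrictTo (U \ B)), componentSign R κ γ (U \ B) := by
  set m := U.min' hU with hm
  have h1 : ∀ B ∈ U.powerset.filter (m ∈ ·), (if ConstantOn κ B then -1 else 0) *
        rootedCount R G m B *
        ∑ γ : AcyclicOrientation (G.restrictTo (U \ B)), componentSign R κ γ (U \ B) =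
      ∑ γ : AcyclicOrientation (G.restrictTo U), if γ.reachableIn U m = B then
        (if ConstantOn κ B then -1 else 0) * componentSign R κ γ (U \ B) else 0 := by
    intro B hB
    obtain ⟨hBU, hmB⟩ := Finset.mem_filter.1 hB
    rw [Finset.mem_powerset] at hBU
    have h := sum_closed (R := R) (G := G) hBU (fun α β => (if ConstantOn κ B then -1 else 0) *
      (if β.Rooted m B then 1 else 0) * componentSign R κ α (U \ B))
    rw [rootedCount, mul_assoc, Finset.sum_mul_sum]
    simp only [Finset.mul_sum, ← mul_assoc]
    rw [Finset.sum_comm, ← h]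
    refine Finset.sum_congr rfl fun γ _ => ?_
    simp only [γ.reachableIn_eq_iff hBU hmB]
    by_cases hcl : γ.Closed B
    · have : componentSign R κ (γ.restrict (U \ B) Finset.sdiff_subset) (U \ B) =
          componentSign R κ γ (U \ B) := by
        rw [componentSign, componentSign, sourceComponentsFrom_congr]
        exact fun u hu v hv => hcl.restrict_sdiff_reach_iff hv
      rw [this]
      by_cases hr : (γ.restrict B hBU).Rooted m B <;> simp [hcl, hr]
    · simp [hcl]
  rw [Finset.sum_congr rfl h1, Finset.sum_comm]
  refine Finset.sum_congr rfl fun γ _ => ?_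
  rw [Finset.sum_ite_eq, if_pos, componentSign_of_nonempty R κ γ hU]
  exact Finset.mem_filter.2 ⟨Finset.mem_powerset.2 (γ.reachableIn_subset U m),
    γ.min'_mem_reachableIn U hU⟩

/-- The signed count of acyclic orientations all of whose source components are monochromatic
detects proper colourings. -/
theorem sum_componentSign_restrictTo [Finite V] (G : SimpleGraph V) (κ : V → α) (U : Finset V) :
    ∑ γ : AcyclicOrientation (G.restrictTo U), componentSign R κ γ U =
      stableSign R (G.monochromatic κ) U := by
  classical
  induction U using Finset.strongInduction with
  | H U ih =>
    by_cases hU : U.Nonempty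
    · rw [sum_componentSign_of_nonempty R G κ hU, ← neg_neg (stableSign R _ U),
        ← sum_rootedCount_mul_stableSign R _ (U.min'_mem hU), ← Finset.sum_neg_distrib]
      refine Finset.sum_congr rfl fun B hB => ?_
      obtain ⟨hBU, hmB⟩ := Finset.mem_filter.1 hB
      rw [Finset.mem_powerset] at hBU
      rw [ih _ (Finset.sdiff_ssubset hBU ⟨_, hmB⟩)]
      -- If `κ` is constant on `B`, all edges inside `B` are monochromatic and the two rooted counts
      -- agree; otherwise both terms vanish.
      split_ifs with hκ
      · rw [rootedCount, rootedCount, G.restrictTo_monochromatic hκ]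
        ring
      · rw [rootedCount_monochromatic_eq_zero R G hκ]
        ring
    · rw [Finset.not_nonempty_iff_eq_empty] at hU
      subst hU
      have : Fact (∀ u v, ¬ (G.restrictTo ∅).Adj u v) := ⟨fun u v h => by simpa using h.2.1⟩
      rw [Fintype.sum_unique, componentSign, sourceComponentsFrom]
      simp [stableSign]

open scoped Classical in
theorem sum_componentSign [Fintype V] (G : SimpleGraph V) (κ : V → α) :
    ∑ γ : AcyclicOrientation G, componentSign R κ γ Finset.univ =
      if ∀ u v, G.Adj u v → κ u ≠ κ v then (-1) ^ Fintype.card V else 0 := by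
  have h := sum_componentSign_restrictTo R G κ Finset.univ
  rw [G.restrictTo_univ] at h
  rw [h, stableSign]
  simp [SimpleGraph.monochromatic]

/-! ### Expanding products of power sums into colourings. -/

theorem componentSign_congr {G : SimpleGraph V} {κ κ' : V → α} (γ : AcyclicOrientation G)
    (U : Finset V) (h : ∀ v ∈ U, κ v = κ' v) :
    componentSign R κ γ U = componentSign R κ' γ U := by
  classical
  induction U using Finset.strongInduction with
  | H U ih =>
    by_cases hU : U.Nonempty
    · have hsub := γ.reachableIn_subset U (U.min' hU)
      have hC : ConstantOn κ (γ.reachableIn U (U.min' hU)) ↔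
          ConstantOn κ' (γ.reachableIn U (U.min' hU)) :=
        forall₂_congr fun u hu => forall₂_congr fun v hv => by rw [h u (hsub hu), h v (hsub hv)]
      rw [componentSign_of_nonempty R κ γ hU, componentSign_of_nonempty R κ' γ hU,
        ih _ (Finset.sdiff_ssubset hsub ⟨_, γ.min'_mem_reachableIn U hU⟩)
          fun v hv => h v (Finset.mem_sdiff.1 hv).1]
      simp only [hC]
    · rw [Finset.not_nonempty_iff_eq_empty] at hU
      subst hU
      simp [componentSign, sourceComponentsFrom]

/-- Expansion of a product of power sums over the source components. -/
theorem prod_sourceComponentsFrom_sum {G : SimpleGraph V} [Fintype V] [DecidableEq α]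
    (γ : AcyclicOrientation G) (w : V → ℕ) (F : Finset α) (a : α) (x : α → R) (U : Finset V) :
    ((γ.sourceComponentsFrom U).map fun C => -∑ i ∈ F, x i ^ ∑ v ∈ C, w v).prod =
      ∑ κ ∈ Fintype.piFinset (fun v => if v ∈ U then F else {a}),
        componentSign R κ γ U * ∏ v ∈ U, x (κ v) ^ w v := by
  classical
  induction U using Finset.strongInduction with
  | H U ih =>
    by_cases hU : U.Nonempty
    · have hsub := γ.reachableIn_subset U (U.min' hU)
      have hmem := γ.min'_mem_reachableIn U hU
      simp only [componentSign_of_nonempty R _ γ hU]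
      rw [sourceComponentsFrom, dif_pos hU, List.map_cons, List.prod_cons]
      -- From here on only `m ∈ C ⊆ U` matters.
      generalize U.min' hU = m at *
      generalize γ.reachableIn U m = C at *
      rw [ih _ (Finset.sdiff_ssubset hsub ⟨_, hmem⟩)]
      simp only [ite_mul, zero_mul]
      rw [← Finset.sum_filter, ← Finset.sum_neg_distrib, Finset.sum_mul_sum,
        ← Finset.sum_product']
      -- A colouring of `U` constant on `C` is a colour for `C`, read off at `m`, together with a
      -- colouring of `U \ C`. The default colour `a` off the current set makes each such colouring
      -- occur once.
      refine Finset.sum_bij' (fun p _ v => if v ∈ C then p.1 else p.2 v)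
        (fun κ _ => (κ m, fun v => if v ∈ C then a else κ v)) ?_ ?_ ?_ ?_ ?_
      · rintro ⟨i, κ⟩ h
        simp only [Finset.mem_product, Fintype.mem_piFinset, Finset.mem_sdiff, Finset.mem_filter]
          at h ⊢
        refine ⟨fun v => ?_, fun u hu v hv => by simp [hu, hv]⟩
        have h2 := h.2 v
        by_cases hv : v ∈ C
        · simp [hv, hsub hv, h.1]
        · simpa [hv] using h2
      · intro κ h
        simp only [Finset.mem_product, Fintype.mem_piFinset, Finset.mem_sdiff, Finset.mem_filter]
          at h ⊢
        refine ⟨by simpa [hsub hmem] using h.1 m, fun v => ?_⟩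
        have h2 := h.1 v
        by_cases hv : v ∈ C
        · simp [hv]
        · simpa [hv] using h2
      · rintro ⟨i, κ⟩ h
        simp only [Finset.mem_product, Fintype.mem_piFinset, Finset.mem_sdiff] at h
        refine Prod.ext (by simp [hmem]) (funext fun v => ?_)
        by_cases hv : v ∈ C
        · have h2 : κ v = a := by simpa [hv] using h.2 v
          simp [hv, h2]
        · simp [hv]
      · intro κ h
        obtain ⟨-, h⟩ := Finset.mem_filter.1 h
        funext v
        by_cases hv : v ∈ C
        · simpa [hv] using h m hmem v hv
        · simp [hv]
      · rintro ⟨i, κ⟩ h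
        have h1 : ∏ v ∈ C, x (if v ∈ C then i else κ v) ^ w v = x i ^ ∑ v ∈ C, w v := by
          rw [← Finset.prod_pow_eq_pow_sum]
          exact Finset.prod_congr rfl fun v hv => by rw [if_pos hv]
        have h2 : ∏ v ∈ U \ C, x (if v ∈ C then i else κ v) ^ w v =
            ∏ v ∈ U \ C, x (κ v) ^ w v :=
          Finset.prod_congr rfl fun v hv => by rw [if_neg (Finset.mem_sdiff.1 hv).2]
        rw [← Finset.prod_sdiff hsub, h1, h2,
          componentSign_congr R (κ := fun v => if v ∈ C then i else κ v) (κ' := κ) γ (U \ C)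
            fun v hv => if_neg (Finset.mem_sdiff.1 hv).2]
        ring
    · rw [Finset.not_nonempty_iff_eq_empty] at hU
      subst hU
      simp [componentSign, sourceComponentsFrom, Fintype.piFinset_singleton]

end

/-! ### Reduction to finitely many variables and comparison of coefficients. -/

section
open AcyclicOrientation

/-- Two power series that agree on all monomials in the variables of `F`. -/
def AgreeOn {R σ : Type*} [CommRing R] (F : Finset σ) (f g : MvPowerSeries σ R) : Prop :=
  ∀ d : σ →₀ ℕ, d.support ⊆ F → MvPowerSeries.coeff d f = MvPowerSeries.coeff d g

namespace AgreeOn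

variable {R σ : Type*} [CommRing R] {F : Finset σ}

theorem mul {f g f' g' : MvPowerSeries σ R} (h : AgreeOn F f g) (h' : AgreeOn F f' g') :
    AgreeOn F (f * f') (g * g') := by
  classical
  intro d hd
  rw [MvPowerSeries.coeff_mul, MvPowerSeries.coeff_mul]
  refine Finset.sum_congr rfl fun p hp => ?_
  rw [Finset.HasAntidiagonal.mem_antidiagonal] at hp
  rw [h _ ((Finsupp.support_mono (hp ▸ le_self_add)).trans hd),
    h' _ ((Finsupp.support_mono (hp ▸ le_add_self)).trans hd)]

theorem list_prod_map {ι : Type*} {f g : ι → MvPowerSeries σ R} (L : List ι)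
    (h : ∀ i ∈ L, AgreeOn F (f i) (g i)) : AgreeOn F (L.map f).prod (L.map g).prod := by
  induction L with
  | nil => exact fun _ _ => rfl
  | cons i L ih =>
    rw [List.map_cons, List.map_cons, List.prod_cons, List.prod_cons]
    exact (h i List.mem_cons_self).mul (ih fun j hj => h j (List.mem_cons_of_mem _ hj))

end AgreeOn

/-- A positive power of a variable outside `F` has no monomial supported in `F`. -/
theorem agreeOn_powerSum (R : Type*) [CommRing R] (F : Finset ℕ+) {n : ℕ} (hn : 0 < n) :
    AgreeOn F (powerSum R n) (∑ i ∈ F, MvPowerSeries.X i ^ n) := by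
  classical
  intro d hd
  rw [map_sum]
  refine finsum_eq_sum_of_support_subset _ fun i hi => ?_
  rw [Function.mem_support, MvPowerSeries.coeff_X_pow, ne_eq, ite_eq_right_iff,
    Classical.not_imp] at hi
  exact hd (by simp [hi.1, hn.ne'])

open scoped Classical in
theorem coeff_chromaticSymmetricFunction (R : Type*) [CommRing R] {V : Type*} [Fintype V] [DecidableEq V]
    (G : SimpleGraph V) (w : V → ℕ+) (d : ℕ+ →₀ ℕ) :
    MvPowerSeries.coeff d (chromaticSymmetricFunction R G w) =
      ∑ κ ∈ Fintype.piFinset (fun _ : V => d.support), if ∀ u v, G.Adj u v → κ u ≠ κ v then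
        MvPowerSeries.coeff d (∏ v : V, (MvPowerSeries.X (κ v) : MvPowerSeries ℕ+ R) ^ (w v : ℕ))
      else 0 := by
  set h : (V → ℕ+) → R := fun κ => MvPowerSeries.coeff d
    (∏ v : V, (MvPowerSeries.X (κ v) : MvPowerSeries ℕ+ R) ^ (w v : ℕ)) with hh
  have h1 : MvPowerSeries.coeff d (chromaticSymmetricFunction R G w) =
      ∑ᶠ κ : G.Coloring ℕ+, h κ := rfl
  -- Weights are positive, so every colour used by `κ` divides its monomial and must occur in `d`.
  have hzero : ∀ κ : V → ℕ+, h κ ≠ 0 → ∀ v, κ v ∈ d.support := by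
    intro κ hκ v
    by_contra hv
    refine hκ ?_
    rw [hh]
    dsimp only
    rw [← Finset.mul_prod_erase _ _ (Finset.mem_univ v), MvPowerSeries.coeff_mul]
    refine Finset.sum_eq_zero fun p hp => ?_
    rw [Finset.HasAntidiagonal.mem_antidiagonal] at hp
    rw [MvPowerSeries.coeff_X_pow, if_neg, zero_mul]
    intro hp1
    refine hv (Finsupp.support_mono (hp ▸ le_self_add : p.1 ≤ d) ?_)
    simp [hp1]
  have h2 : ∀ κ : V → ℕ+, κ ∈ Set.range (fun κ : G.Coloring ℕ+ => (κ : V → ℕ+)) ↔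
      ∀ u v, G.Adj u v → κ u ≠ κ v :=
    fun κ => ⟨by rintro ⟨c, rfl⟩ u v huv; exact c.valid huv,
      fun hκ => ⟨SimpleGraph.Coloring.mk κ fun {u v} huv => hκ u v huv, rfl⟩⟩
  rw [h1, ← finsum_mem_range (f := h) (g := fun κ : G.Coloring ℕ+ => (κ : V → ℕ+))
    DFunLike.coe_injective, ← Finset.sum_filter]
  refine finsum_mem_eq_sum_of_inter_support_eq _ ?_
  ext κ
  simp only [Set.mem_inter_iff, h2, Function.mem_support, Finset.coe_filter,
    Fintype.mem_piFinset, Set.mem_ofPred_eq]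
  exact ⟨fun ⟨a, b⟩ => ⟨⟨hzero κ b, a⟩, b⟩, fun ⟨⟨_, a⟩, b⟩ => ⟨a, b⟩⟩

theorem coeff_sign_mul_powerSumPartition (R : Type*) [CommRing R] {V : Type*} [Fintype V]
    [LinearOrder V] {G : SimpleGraph V} (γ : AcyclicOrientation G) (w : V → ℕ+) (d : ℕ+ →₀ ℕ) :
    MvPowerSeries.coeff d ((-1) ^ (γ.sourcePartition w).parts.card *
        powerSumPartition R (γ.sourcePartition w)) =
      ∑ κ ∈ Fintype.piFinset (fun _ : V => d.support),
        componentSign R κ γ Finset.univ * MvPowerSeries.coeff d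
          (∏ v : V, (MvPowerSeries.X (κ v) : MvPowerSeries ℕ+ R) ^ (w v : ℕ)) := by
  classical
  have h1 : (-1) ^ (γ.sourcePartition w).parts.card * powerSumPartition R (γ.sourcePartition w) =
      ((γ.sourceComponentsFrom Finset.univ).map
        fun C => -powerSum R (∑ v ∈ C, (w v : ℕ))).prod := by
    simp only [powerSumPartition, sourcePartition, Multiset.coe_card, Multiset.map_coe,
      Multiset.prod_coe, List.length_map, List.map_map, sourceComponents]
    generalize γ.sourceComponentsFrom Finset.univ = L
    induction L with
    | nil => simp
    | cons C L ih =>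
      simp only [List.map_cons, List.prod_cons, List.length_cons, Function.comp_apply, ← ih]
      ring
  have h2 : AgreeOn d.support ((γ.sourceComponentsFrom Finset.univ).map
        fun C => -powerSum R (∑ v ∈ C, (w v : ℕ))).prod
      ((γ.sourceComponentsFrom Finset.univ).map fun C => -∑ i ∈ d.support,
        (MvPowerSeries.X i : MvPowerSeries ℕ+ R) ^ ∑ v ∈ C, (w v : ℕ)).prod := by
    refine AgreeOn.list_prod_map _ fun C hC e he => ?_
    have := γ.nonempty_of_mem_sourceComponentsFrom _ C hC
    rw [map_neg, map_neg, agreeOn_powerSum R d.support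
      (Finset.sum_pos (fun v _ => (w v).pos) this) e he]
  have hsign : ∀ κ : V → ℕ+, componentSign (MvPowerSeries ℕ+ R) κ γ Finset.univ =
      MvPowerSeries.C (componentSign R κ γ Finset.univ) := by
    intro κ
    rw [componentSign, componentSign, map_list_prod, List.map_map]
    congr 2
    funext C
    simp only [Function.comp_apply]
    split_ifs <;> simp
  -- The default colour `1` is arbitrary: no vertex lies outside `Finset.univ`.
  rw [h1, h2 d subset_rfl,
    prod_sourceComponentsFrom_sum (MvPowerSeries ℕ+ R) γ (fun v => (w v : ℕ)) d.support 1]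
  simp only [Finset.mem_univ, if_true, map_sum, hsign, MvPowerSeries.coeff_C_mul]

theorem mainTheorem8 (R : Type*) [CommRing R] {V : Type*} [Fintype V] [LinearOrder V]
    (G : SimpleGraph V) (w : V → ℕ+) :
    chromaticSymmetricFunction R G w =
      (-1) ^ Fintype.card V *
        ∑ γ : AcyclicOrientation G,
          (-1) ^ (γ.sourcePartition w).parts.card *
            powerSumPartition R (γ.sourcePartition w) := by
  classical
  ext d
  have hC : ((-1) ^ Fintype.card V : MvPowerSeries ℕ+ R) =
      MvPowerSeries.C ((-1) ^ Fintype.card V) := by simp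
  rw [hC, MvPowerSeries.coeff_C_mul, map_sum, coeff_chromaticSymmetricFunction]
  simp only [coeff_sign_mul_powerSumPartition]
  rw [Finset.sum_comm, Finset.mul_sum]
  refine Finset.sum_congr rfl fun κ _ => ?_
  -- For proper `κ` the two factors `(-1) ^ Fintype.card V` cancel.
  rw [← Finset.sum_mul, sum_componentSign, ← mul_assoc, mul_ite, ← mul_pow]
  split_ifs <;> simp

end
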